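/- A $D$-set is a set $\Omega$ with a $4$-ary relation $D(wx;yz)$ such that for all $w,x,y,z\in\Omega$: (D1) $D(wx;yz)\rightarrow D(xw;yz)\wedge D(yz;wx)$; (D2) $D(wx;yz)\rightarrow\neg D(wy;xz)$; (D3) $D(wx;yz)\rightarrow\forall v\,(D(vx;yz)\vee D(wx;yv))$; (D4) $(w\neq y\wedge x\neq y)\rightarrow D(wx;yy)$. It is proper if $|\Omega|\ge 3$ and (D5) for all distinct $w,x,y$ there is $z\neq y$ with $D(wx;yz)$. A colored $D$-set is a $D$-set with finitely many unary predicates $P_1,\dots,P_k$ that partition $\Omega$ into nonempty sets. A structure is homogeneous (ultrahomogeneous) if every isomorphism between finitely generated substructures extends to an automorphism. A sequence of tuples indexed by a linear order is indiscernible over a set $A$ if the truth of a first-order formula with parameters from $A$ is the same at any two strictly increasing finite subsequences of the same length; two sequences are mutually indiscernible if each is indiscernible over the set of all entries of the other. A theory $T$ is dp-minimal if for every model $M$ of $T$, all mutually indiscernible infinite sequences $s_1,s_2$ of finite tuples of $M$ and every $b\in M$, at least one of $s_1,s_2$ is indiscernible over $\{b\}$. A structure is dp-minimal if its complete theory is.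 **Theorem 2.** Let $T$ be the complete first-order theory of a $D$-set augmented with unary predicates (arbitrarily many), and suppose that $T$ has quantifier elimination. Then $T$ is dp-minimal. In particular, every countable proper homogeneous colored $D$-set is dp-minimal. -/

import Mathlib

universe u v w x y

namespace ColoredDSet

open FirstOrder FirstOrder.Language

/-! ### D-sets -/

/-- The axioms (D1)-(D4) of Adeleke and Neumann for a quaternary relation `D(wx;yz)`. -/
structure IsDSet {Ω : Type v} (D : Ω → Ω → Ω → Ω → Prop) : Prop where
  d1 : ∀ w x y z, D w x y z → D x w y z ∧ D y z w x
  d2 : ∀ w x y z, D w x y z → ¬ D w y x z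
  d3 : ∀ w x y z, D w x y z → ∀ t, D t x y z ∨ D w x y t
  d4 : ∀ w x y, w ≠ y → x ≠ y → D w x y y

/-- A proper D-set: at least three elements, and axiom (D5). -/
structure IsProperDSet {Ω : Type v} (D : Ω → Ω → Ω → Ω → Prop) : Prop extends IsDSet D where
  three_le_card : 3 ≤ ENat.card Ω
  d5 : ∀ w x y, w ≠ x → w ≠ y → x ≠ y → ∃ z, z ≠ y ∧ D w x y z

/-- A coloring: the predicates `P i` form a partition into nonempty sets. -/
structure IsColoring {Ω : Type v} {ι : Type u} (P : ι → Set Ω) : Prop where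
  nonempty : ∀ i, (P i).Nonempty
  existsUnique : ∀ a, ∃! i, a ∈ P i

/-! ### The first-order language of D-sets with unary predicates -/

/-- One quaternary relation symbol, and a unary relation symbol for each `i : ι`. -/
inductive Relations (ι : Type u) : ℕ → Type u
  | d : Relations ι 4
  | color (i : ι) : Relations ι 1

/-- The language `{D} ∪ {P i : i ∈ ι}`, without function or constant symbols. -/
def lang (ι : Type u) : FirstOrder.Language.{0, u} where
  Functions := fun _ => Empty
  Relations := Relations ι

/-- The interpretation of the symbol `D` in a structure. -/
def dRel (ι : Type u) (Ω : Type v) [(lang ι).Structure Ω] (w x y z : Ω) : Prop :=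
  Structure.RelMap (L := lang ι) (Relations.d : Relations ι 4) ![w, x, y, z]

/-- The interpretation of the symbol `P i` in a structure. -/
def colorSet {ι : Type u} (Ω : Type v) [(lang ι).Structure Ω] (i : ι) : Set Ω :=
  {a | Structure.RelMap (L := lang ι) (Relations.color i : Relations ι 1) ![a]}

/-! ### Quantifier elimination, indiscernible sequences, dp-minimality -/

/-- `T` has quantifier elimination: every formula is equivalent modulo `T` to a quantifier-free
formula in the same free variables. -/
def HasQE {L : FirstOrder.Language.{u, v}} (T : L.Theory) : Prop :=
  ∀ (n : ℕ) (φ : L.Formula (Fin n)), ∃ ψ : L.Formula (Fin n), ψ.IsQF ∧ (φ ⇔[T] ψ)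

/-- The sequence `(a i : i ∈ I)` of `m`-tuples is (order) indiscernible over the set `A`: the truth
of a formula with parameters from `A` is the same at any two strictly increasing `n`-tuples of
members of the sequence. -/
def IsIndiscernibleOver (L : FirstOrder.Language.{u, v}) {M : Type w} [L.Structure M] {I : Type x}
    [LinearOrder I] {m : ℕ} (A : Set M) (a : I → Fin m → M) : Prop :=
  ∀ (n : ℕ) (φ : L.Formula ((Fin n × Fin m) ⊕ A)) (i j : Fin n → I),
    StrictMono i → StrictMono j →
      (φ.Realize (Sum.elim (fun p => a (i p.1) p.2) (fun c : A => (c : M))) ↔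
        φ.Realize (Sum.elim (fun p => a (j p.1) p.2) (fun c : A => (c : M))))

/-- The elements that occur in the tuples of a sequence. -/
def entries {M : Type w} {I : Type x} {m : ℕ} (a : I → Fin m → M) : Set M :=
  {c | ∃ i k, a i k = c}

/-- Each of the two sequences is indiscernible over the elements of the other. -/
def MutuallyIndiscernible (L : FirstOrder.Language.{u, v}) {M : Type w} [L.Structure M] {I : Type x}
    {J : Type y} [LinearOrder I] [LinearOrder J] {m n : ℕ}
    (a : I → Fin m → M) (b : J → Fin n → M) : Prop :=
  IsIndiscernibleOver L (entries b) a ∧ IsIndiscernibleOver L (entries a) b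

/-- `T` is dp-minimal: in every model, given two mutually indiscernible infinite sequences of
finite tuples and a single element `c`, one of the sequences is indiscernible over `c`.
The universes of the models and of the two index orders are parameters. -/
def IsDPMinimal {L : FirstOrder.Language.{u, v}} (T : L.Theory) : Prop :=
  ∀ (M : Type w) [L.Structure M] [M ⊨ T] (I : Type x) (J : Type y) [LinearOrder I]
    [LinearOrder J] [Infinite I] [Infinite J] (m n : ℕ) (a : I → Fin m → M) (b : J → Fin n → M),
    MutuallyIndiscernible L a b →
      ∀ c : M, IsIndiscernibleOver L {c} a ∨ IsIndiscernibleOver L {c} b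

end ColoredDSet

namespace ColoredDSet

open FirstOrder FirstOrder.Language

/-! ### Combinatorics of D-sets -/

namespace IsDSet

variable {Ω : Type v} {D : Ω → Ω → Ω → Ω → Prop}

/-! Call the set of all `v` with `D v x y z` a cut. Quantifier elimination reduces indiscernibility
over `c` to atomic formulas. If `c` is not an entry, the only ones that can change are those saying
whether `c` lies in a cut given by entries (`exists_cut_of_not_isIndiscernibleOver`). So if `c`
spoils both sequences, each has a cut that contains `c` and a cut defined alike at other indices
that misses `c`. Two cuts are disjoint, nested or cover everything (`IsDSet.cut_cases`). Which of
these holds is a first-order property of the entries, so mutual indiscernibility lets the indices of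
each sequence be moved independently. Every alternative then puts `c` on the wrong side of some cut.
For the homogeneous case, finitely many colors leave finitely many atomic formulas in `n` variables,
and homogeneity makes them determine the truth of every formula. -/

theorem swap_left_iff (hD : IsDSet D) {w x y z : Ω} : D w x y z ↔ D x w y z :=
  ⟨fun h => (hD.d1 _ _ _ _ h).1, fun h => (hD.d1 _ _ _ _ h).1⟩

theorem swap_pairs_iff (hD : IsDSet D) {w x y z : Ω} : D w x y z ↔ D y z w x :=
  ⟨fun h => (hD.d1 _ _ _ _ h).2, fun h => (hD.d1 _ _ _ _ h).2⟩

theorem swap_right_iff (hD : IsDSet D) {w x y z : Ω} : D w x y z ↔ D w x z y := by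
  rw [hD.swap_pairs_iff, hD.swap_left_iff, hD.swap_pairs_iff]

theorem not_left_eq (hD : IsDSet D) (w x z : Ω) : ¬ D w x w z := by
  intro h
  by_cases hx : x = w
  · subst hx
    exact hD.d2 _ _ _ _ h h
  by_cases hz : z = w
  · subst hz
    have h' := hD.swap_pairs_iff.1 h
    exact hD.d2 _ _ _ _ h' h'
  exact hD.d2 _ _ _ _ h (hD.swap_pairs_iff.1 (hD.d4 x z w hx hz))

/-- Two points inside a cut are separated from two points outside it. -/
theorem separates (hD : IsDSet D) {x y z p q r s : Ω} (hp : D p x y z) (hq : D q x y z)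
    (hr : ¬ D r x y z) (hs : ¬ D s x y z) : D p q r s := by
  have left {w x y z} := (hD.swap_left_iff (w := w) (x := x) (y := y) (z := z)).1
  have right {w x y z} := (hD.swap_right_iff (w := w) (x := x) (y := y) (z := z)).1
  -- Move the right-hand pair out to `r`, `s` by (D3); failure would yield `D x s r z` and `D x r s
  -- z`, against (D2). The same argument below replaces `x` by `q`.
  have key : ∀ p, D p x y z → D p x r s := by
    intro p hp
    have hzr := (hD.d3 _ _ _ _ (right hp) r).resolve_left fun h => hr (right h)
    have hzs := (hD.d3 _ _ _ _ (right hp) s).resolve_left fun h => hs (right h)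
    by_contra h
    have h₁ := (hD.d3 _ _ _ _ (right hzr) s).resolve_right h
    have h₂ := (hD.d3 _ _ _ _ (right hzs) r).resolve_right fun h' => h (right h')
    exact hD.d2 _ _ _ _ (left h₁) (left h₂)
  rcases hD.d3 _ _ _ _ (left (key p hp)) q with h | h
  · exact left h
  rcases hD.d3 _ _ _ _ (left (key q hq)) p with h' | h'
  · exact h'
  exact absurd (right h') (hD.d2 _ _ _ _ (right h))

/-- Any two cuts are disjoint, nested or cover the whole set. -/
theorem cut_cases (hD : IsDSet D) (x y z x' y' z' : Ω) :
    (∀ v, D v x y z → ¬ D v x' y' z') ∨ (∀ v, D v x y z → D v x' y' z') ∨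
      (∀ v, D v x' y' z' → D v x y z) ∨ (∀ v, ¬ D v x y z → D v x' y' z') := by
  -- Otherwise each region of the Venn diagram of the two cuts has a point; the first cut separates
  -- `p`, `q` from `r`, `s`, the second `p`, `r` from `q`, `s`, against (D2).
  by_contra! h
  obtain ⟨⟨p, hp, hp'⟩, ⟨q, hq, hq'⟩, ⟨r, hr', hr⟩, s, hs, hs'⟩ := h
  exact hD.d2 _ _ _ _ (hD.separates hp hq hr hs) (hD.separates hp' hr' hq' hs')

/-- The relation `D` on a tuple extended by an outside point `c` is determined by its values on
the tuple and on the quadruples in which `c` is the first entry. -/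
theorem iff_of_agree (hD : IsDSet D) {β : Type*} {f g : β → Ω} {c : Ω}
    (hf : ∀ p, f p ≠ c) (hg : ∀ p, g p ≠ c)
    (h4 : ∀ p q r s, D (f p) (f q) (f r) (f s) ↔ D (g p) (g q) (g r) (g s))
    (h3 : ∀ p q r, D c (f p) (f q) (f r) ↔ D c (g p) (g q) (g r))
    {γ : Type*} (p q r s : β ⊕ γ) :
    D (Sum.elim f (fun _ => c) p) (Sum.elim f (fun _ => c) q) (Sum.elim f (fun _ => c) r)
        (Sum.elim f (fun _ => c) s) ↔
      D (Sum.elim g (fun _ => c) p) (Sum.elim g (fun _ => c) q) (Sum.elim g (fun _ => c) r)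
        (Sum.elim g (fun _ => c) s) := by
  have n1 : ∀ x z, ¬ D c x c z := fun x z => hD.not_left_eq c x z
  have n2 : ∀ x z, ¬ D x c c z := fun x z h => n1 x z (hD.swap_left_iff.1 h)
  have n3 : ∀ x z, ¬ D c x z c := fun x z h => n1 x z (hD.swap_right_iff.1 h)
  have n4 : ∀ x z, ¬ D x c z c := fun x z h => n2 x z (hD.swap_right_iff.1 h)
  have tf : ∀ p q, D (f p) (f q) c c := fun p q => hD.d4 _ _ _ (hf p) (hf q)
  have tg : ∀ p q, D (g p) (g q) c c := fun p q => hD.d4 _ _ _ (hg p) (hg q)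
  have tf' : ∀ p q, D c c (f p) (f q) := fun p q => hD.swap_pairs_iff.1 (tf p q)
  have tg' : ∀ p q, D c c (g p) (g q) := fun p q => hD.swap_pairs_iff.1 (tg p q)
  have h3' : ∀ p q r, D (f p) c (f q) (f r) ↔ D (g p) c (g q) (g r) := fun p q r => by
    rw [hD.swap_left_iff, h3, hD.swap_left_iff]
  have h3'' : ∀ p q r, D (f p) (f q) c (f r) ↔ D (g p) (g q) c (g r) := fun p q r => by
    rw [hD.swap_pairs_iff, h3, hD.swap_pairs_iff]
  have h3''' : ∀ p q r, D (f p) (f q) (f r) c ↔ D (g p) (g q) (g r) c := fun p q r => by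
    rw [hD.swap_right_iff, h3'', hD.swap_right_iff]
  rcases p with p | p <;> rcases q with q | q <;> rcases r with r | r <;> rcases s with s | s <;>
    simp only [Sum.elim_inl, Sum.elim_inr, n1, n2, n3, n4, tf, tg, tf', tg', h4, h3, h3', h3'',
      h3''']

end IsDSet

/-! ### Formulas in the language of D-sets -/

section Formulas

variable {ι : Type u} {α : Type*}

/-- The formula `D(wx;yz)`. -/
def dFormula (w x y z : α) : (lang ι).Formula α :=
  (show (lang ι).Relations 4 from Relations.d).formula ![.var w, .var x, .var y, .var z]

/-- The formula `P i (x)`. -/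
def colorFormula (i : ι) (x : α) : (lang ι).Formula α :=
  (show (lang ι).Relations 1 from Relations.color i).formula ![.var x]

variable {M : Type w} [(lang ι).Structure M]

@[simp]
theorem realize_dFormula {w x y z : α} {v : α → M} :
    (dFormula w x y z : (lang ι).Formula α).Realize v ↔ dRel ι M (v w) (v x) (v y) (v z) := by
  rw [dFormula, Formula.realize_rel, dRel, iff_eq_eq]
  congr 1
  funext k
  fin_cases k <;> rfl

@[simp]
theorem realize_colorFormula {i : ι} {x : α} {v : α → M} :
    (colorFormula i x).Realize v ↔ v x ∈ colorSet M i := by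
  rw [colorFormula, Formula.realize_rel, colorSet, Set.mem_ofPred_eq, iff_eq_eq]
  congr 1
  funext k
  fin_cases k; rfl

@[simp]
theorem realize_varEqual {L : FirstOrder.Language.{u, v}} [L.Structure M] {x y : α} {v : α → M} :
    ((Term.var x).equal (Term.var y) : L.Formula α).Realize v ↔ v x = v y := by
  simp [Formula.realize_equal]

theorem relMap_d_iff (xs : Fin 4 → M) :
    Structure.RelMap (L := lang ι) (Relations.d : Relations ι 4) xs ↔
      dRel ι M (xs 0) (xs 1) (xs 2) (xs 3) := by
  rw [dRel, iff_eq_eq]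
  congr 1
  funext k
  fin_cases k <;> rfl

theorem relMap_color_iff (i : ι) (xs : Fin 1 → M) :
    Structure.RelMap (L := lang ι) (Relations.color i : Relations ι 1) xs ↔
      xs 0 ∈ colorSet M i := by
  rw [colorSet, Set.mem_ofPred_eq, iff_eq_eq]
  congr 1
  funext k
  fin_cases k; rfl

instance : (lang ι).IsRelational := fun _ => inferInstanceAs (IsEmpty Empty)

/-- Quantifier-free formulas cannot distinguish tuples with the same atomic diagram. -/
theorem realize_iff_of_isQF {v v' : α → M} (heq : ∀ p q, v p = v q ↔ v' p = v' q)
    (hd : ∀ p q r s, dRel ι M (v p) (v q) (v r) (v s) ↔ dRel ι M (v' p) (v' q) (v' r) (v' s))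
    (hP : ∀ i p, v p ∈ colorSet (ι := ι) M i ↔ v' p ∈ colorSet (ι := ι) M i)
    {ψ : (lang ι).Formula α} (hψ : ψ.IsQF) : ψ.Realize v ↔ ψ.Realize v' := by
  have hterm : ∀ t : (lang ι).Term (α ⊕ Fin 0), ∃ p, t = .var (.inl p) := by
    rintro (⟨p | p⟩ | ⟨f, -⟩)
    · exact ⟨p, rfl⟩
    · exact p.elim0
    · exact isEmptyElim f
  unfold Formula.Realize
  induction hψ with
  | falsum => rfl
  | imp _ _ h₁ h₂ => exact imp_congr h₁ h₂
  | of_isAtomic h =>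
    cases h with
    | equal t₁ t₂ =>
      obtain ⟨p, rfl⟩ := hterm t₁
      obtain ⟨q, rfl⟩ := hterm t₂
      simpa using heq p q
    | rel R ts =>
      choose k hk using fun l => hterm (ts l)
      simp only [BoundedFormula.realize_rel, hk, Term.realize_var, Sum.elim_inl]
      cases R with
      | d => exact (relMap_d_iff _).trans ((hd _ _ _ _).trans (relMap_d_iff fun l => v' (k l)).symm)
      | color i => exact (relMap_color_iff i _).trans ((hP i _).trans (relMap_color_iff i fun l => v' (k l)).symm)

end Formulas

/-! ### Transfer between models of a complete theory -/

section Transfer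

variable {L : FirstOrder.Language.{u, v}} {α : Type*} [Finite α]

theorem realize_of_forall_realize {Ω : Type*} {M : Type*} [L.Structure Ω] [L.Structure M]
    [M ⊨ L.completeTheory Ω] (φ : L.Formula α) (h : ∀ v : α → Ω, φ.Realize v) (v : α → M) :
    φ.Realize v := by
  let σ : L.Sentence := Formula.iAlls α (φ.relabel (Sum.inr : α → Empty ⊕ α))
  have hΩ : Ω ⊨ σ := by
    simp only [σ, Sentence.Realize, Formula.realize_iAlls, Formula.realize_relabel]
    exact fun i => h _
  have hM : M ⊨ σ := (realize_iff_of_model_completeTheory Ω M σ).2 hΩ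
  simp only [σ, Sentence.Realize, Formula.realize_iAlls, Formula.realize_relabel] at hM
  exact hM v

/-- Passes from `Fin n` to any finite variable type, such as tuple positions together with the
parameter `c`. -/
theorem HasQE.exists_isQF {T : L.Theory} (hT : HasQE T) (φ : L.Formula α) :
    ∃ ψ : L.Formula α, ψ.IsQF ∧ ∀ (M : Type w) [L.Structure M] [M ⊨ T] [Nonempty M] (v : α → M),
      φ.Realize v ↔ ψ.Realize v := by
  obtain ⟨N, ⟨e⟩⟩ := Finite.exists_equiv_fin α
  obtain ⟨ψ, hψ, h⟩ := hT N (φ.relabel e)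
  refine ⟨ψ.relabel e.symm, hψ.relabel _, fun M _ _ _ v => ?_⟩
  have key : (φ.relabel e).Realize (v ∘ e.symm) ↔ ψ.Realize (v ∘ e.symm) := by
    have := Theory.ModelsBoundedFormula.realize_formula h M (v := v ∘ e.symm)
    rwa [Formula.realize_iff] at this
  rw [Formula.realize_relabel] at key ⊢
  rw [← key, Function.comp_assoc, e.symm_comp_self, Function.comp_id]

end Transfer

theorem IsDSet.of_model {ι : Type u} {Ω : Type*} {M : Type*} [(lang ι).Structure Ω]
    [(lang ι).Structure M] [M ⊨ (lang ι).completeTheory Ω] (hD : IsDSet (dRel ι Ω)) :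
    IsDSet (dRel ι M) where
  d1 w x y z := by
    have := realize_of_forall_realize (Ω := Ω) (M := M)
      ((dFormula 0 1 2 3).imp (dFormula 1 0 2 3 ⊓ dFormula 2 3 0 1) : (lang ι).Formula (Fin 4))
      (fun v => by simpa [Formula.realize_imp] using hD.d1 _ _ _ _) ![w, x, y, z]
    simpa [Formula.realize_imp] using this
  d2 w x y z := by
    have := realize_of_forall_realize (Ω := Ω) (M := M)
      ((dFormula 0 1 2 3).imp (dFormula 0 2 1 3).not : (lang ι).Formula (Fin 4))
      (fun v => by simpa [Formula.realize_imp] using hD.d2 _ _ _ _) ![w, x, y, z]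
    simpa [Formula.realize_imp] using this
  d3 w x y z h t := by
    have := realize_of_forall_realize (Ω := Ω) (M := M)
      ((dFormula 0 1 2 3).imp (dFormula 4 1 2 3 ⊔ dFormula 0 1 2 4) : (lang ι).Formula (Fin 5))
      (fun v => by simpa [Formula.realize_imp] using fun h => hD.d3 _ _ _ _ h _) ![w, x, y, z, t]
    simpa [Formula.realize_imp, h] using this
  d4 w x y h h' := by
    have := realize_of_forall_realize (Ω := Ω) (M := M)
      ((Term.equal (.var 0) (.var 2)).not.imp
        ((Term.equal (.var 1) (.var 2)).not.imp (dFormula 0 1 2 2)) : (lang ι).Formula (Fin 3))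
      (fun v => by simpa [Formula.realize_imp] using hD.d4 _ _ _) ![w, x, y]
    simpa [Formula.realize_imp, h, h'] using this

/-! ### Indiscernible sequences -/

section Indiscernible

variable {L : FirstOrder.Language.{u, v}} {M : Type w} [L.Structure M] {I : Type x} {J : Type y}
  [LinearOrder I] [LinearOrder J] {m n : ℕ} {a : I → Fin m → M} {b : J → Fin n → M}

theorem IsIndiscernibleOver.mono {A B : Set M} (h : IsIndiscernibleOver L B a) (hAB : A ⊆ B) :
    IsIndiscernibleOver L A a := by
  intro k φ i j hi hj
  have := h k (φ.relabel (Sum.map id (Set.inclusion hAB))) i j hi hj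
  rw [Formula.realize_relabel, Formula.realize_relabel, Sum.elim_comp_map, Sum.elim_comp_map]
    at this
  exact this

/-- A formula with parameters indexed by an arbitrary type. -/
theorem IsIndiscernibleOver.realize_iff {A : Set M} (h : IsIndiscernibleOver L A a)
    {β : Type*} {k : ℕ} (φ : L.Formula ((Fin k × Fin m) ⊕ β)) {e : β → M} (he : ∀ p, e p ∈ A)
    {i j : Fin k → I} (hi : StrictMono i) (hj : StrictMono j) :
    φ.Realize (Sum.elim (fun p => a (i p.1) p.2) e) ↔
      φ.Realize (Sum.elim (fun p => a (j p.1) p.2) e) := by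
  have := h k (φ.relabel (Sum.map id (fun p => (⟨e p, he p⟩ : A)))) i j hi hj
  rw [Formula.realize_relabel, Formula.realize_relabel, Sum.elim_comp_map, Sum.elim_comp_map]
    at this
  exact this

theorem IsIndiscernibleOver.realize_iff' {A : Set M} (h : IsIndiscernibleOver L A a)
    {k : ℕ} (φ : L.Formula (Fin k × Fin m))
    {i j : Fin k → I} (hi : StrictMono i) (hj : StrictMono j) :
    φ.Realize (fun p => a (i p.1) p.2) ↔ φ.Realize (fun p => a (j p.1) p.2) := by
  have := h.realize_iff (β := Empty) (φ.relabel Sum.inl) (e := Empty.elim) (fun p => p.elim) hi hj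
  rwa [Formula.realize_relabel, Formula.realize_relabel, Sum.elim_comp_inl, Sum.elim_comp_inl]
    at this

/-- Mutual indiscernibility for formulas in entries of both sequences. -/
theorem MutuallyIndiscernible.realize_iff (h : MutuallyIndiscernible L a b) {k l : ℕ}
    (φ : L.Formula ((Fin k × Fin m) ⊕ (Fin l × Fin n))) {i j : Fin k → I} {i' j' : Fin l → J}
    (hi : StrictMono i) (hj : StrictMono j) (hi' : StrictMono i') (hj' : StrictMono j') :
    φ.Realize (Sum.elim (fun p => a (i p.1) p.2) (fun p => b (i' p.1) p.2)) ↔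
      φ.Realize (Sum.elim (fun p => a (j p.1) p.2) (fun p => b (j' p.1) p.2)) := by
  rw [h.1.realize_iff φ (fun p => ⟨_, _, rfl⟩) hi hj]
  have := h.2.realize_iff (φ.relabel Sum.swap) (e := fun p : Fin k × Fin m => a (j p.1) p.2)
    (fun p => ⟨_, _, rfl⟩) hi' hj'
  rwa [Formula.realize_relabel, Formula.realize_relabel, Sum.elim_swap, Sum.elim_swap] at this

end Indiscernible

/-! ### Cuts that witness the loss of indiscernibility -/

section Distinguish

variable {ι : Type u} {M : Type w} [(lang ι).Structure M] {I : Type x} {J : Type y}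
  [LinearOrder I] [LinearOrder J] {m n : ℕ} {a : I → Fin m → M} {b : J → Fin n → M}

/-- If adding a new point `c` destroys indiscernibility, then this is witnessed by cuts. -/
theorem exists_cut_of_not_isIndiscernibleOver {T : (lang ι).Theory} [M ⊨ T] (hT : HasQE T)
    (hD : IsDSet (dRel ι M)) {A : Set M} (ha : IsIndiscernibleOver (lang ι) A a) {c : M}
    (hc : c ∉ entries a) (hac : ¬ IsIndiscernibleOver (lang ι) {c} a) :
    ∃ (k : ℕ) (i j : Fin k → I) (p q r : Fin k × Fin m), StrictMono i ∧ StrictMono j ∧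
      dRel ι M c (a (i p.1) p.2) (a (i q.1) q.2) (a (i r.1) r.2) ∧
      ¬ dRel ι M c (a (j p.1) p.2) (a (j q.1) q.2) (a (j r.1) r.2) := by
  by_contra! H
  refine hac fun k φ i j hi hj => ?_
  have : Nonempty M := ⟨c⟩
  obtain ⟨ψ, hψ, hφψ⟩ := hT.exists_isQF φ
  rw [hφψ, hφψ]
  have hcon : (fun d : ({c} : Set M) => (d : M)) = fun _ => c := funext fun d => d.2
  rw [hcon]
  have hne : ∀ i k, a i k ≠ c := fun i k h => hc ⟨i, k, h⟩
  refine realize_iff_of_isQF ?_ ?_ ?_ hψ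
  · rintro (p | p) (q | q)
    · simpa using ha.realize_iff' (Term.equal (.var p) (.var q)) hi hj
    · simp [hne]
    · simp [(hne _ _).symm]
    · simp
  · refine hD.iff_of_agree (fun p => hne _ _) (fun p => hne _ _) (fun p q r s => ?_)
      -- `H` is one implication for all pairs of index tuples, so exchanging `i` and `j` gives the
      -- converse.
      (fun p q r => ⟨H k i j p q r hi hj, H k j i p q r hj hi⟩)
    simpa using ha.realize_iff' (dFormula p q r s) hi hj
  · rintro l (p | p)
    · simpa using ha.realize_iff' (colorFormula l p) hi hj
    · simp

theorem MutuallyIndiscernible.isIndiscernibleOver_or {T : (lang ι).Theory} [M ⊨ T] (hT : HasQE T)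
    (hD : IsDSet (dRel ι M)) (hab : MutuallyIndiscernible (lang ι) a b) (c : M) :
    IsIndiscernibleOver (lang ι) {c} a ∨ IsIndiscernibleOver (lang ι) {c} b := by
  -- An entry of one sequence is already a parameter over which the other is indiscernible.
  by_cases ha : c ∈ entries a
  · exact .inr (hab.2.mono (Set.singleton_subset_iff.2 ha))
  by_cases hb : c ∈ entries b
  · exact .inl (hab.1.mono (Set.singleton_subset_iff.2 hb))
  by_contra! h
  obtain ⟨k, i, j, p, q, r, hi, hj, hci, hcj⟩ :=
    exists_cut_of_not_isIndiscernibleOver hT hD hab.1 ha h.1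
  obtain ⟨l, i', j', p', q', r', hi', hj', hci', hcj'⟩ :=
    exists_cut_of_not_isIndiscernibleOver hT hD hab.2 hb h.2
  let V := (Fin k × Fin m) ⊕ (Fin l × Fin n)
  let A : (lang ι).Formula (V ⊕ Unit) :=
    dFormula (.inr ()) (.inl (.inl p)) (.inl (.inl q)) (.inl (.inl r))
  let B : (lang ι).Formula (V ⊕ Unit) :=
    dFormula (.inr ()) (.inl (.inr p')) (.inl (.inr q')) (.inl (.inr r'))
  -- The `Unit` variable is the point of the cuts; quantifying over it leaves a parameter-free
  -- condition on entries, which transfers.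
  have tr (φ : (lang ι).Formula (V ⊕ Unit)) := fun s t s' t' hs ht hs' ht' =>
    hab.realize_iff (Formula.iAlls Unit φ) (i := s) (j := t) (i' := s') (j' := t') hs ht hs' ht'
  simp only [Formula.realize_iAlls] at tr
  rcases hD.cut_cases (a (i p.1) p.2) (a (i q.1) q.2) (a (i r.1) r.2)
    (b (i' p'.1) p'.2) (b (i' q'.1) q'.2) (b (i' r'.1) r'.2) with h | h | h | h
  · exact h c hci hci'
  -- In the nested cases only the larger cut is moved, to the one missing `c`; in the covering case
  -- both are.
  · have := (tr (A.imp B) i i i' j' hi hi hi' hj').1 (by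
      simpa [A, B, Formula.realize_imp] using fun f : Unit → M => h (f ())) (fun _ => c)
    simp only [A, B, Formula.realize_imp, realize_dFormula, Sum.elim_inl, Sum.elim_inr] at this
    exact hcj' (this hci)
  · have := (tr (B.imp A) i j i' i' hi hj hi' hi').1 (by
      simpa [A, B, Formula.realize_imp] using fun f : Unit → M => h (f ())) (fun _ => c)
    simp only [A, B, Formula.realize_imp, realize_dFormula, Sum.elim_inl, Sum.elim_inr] at this
    exact hcj (this hci')
  · have := (tr (A.not.imp B) i j i' j' hi hj hi' hj').1 (by
      simpa [A, B, Formula.realize_imp] using fun f : Unit → M => h (f ())) (fun _ => c)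
    simp only [A, B, Formula.realize_imp, Formula.realize_not, realize_dFormula, Sum.elim_inl,
      Sum.elim_inr] at this
    exact hcj' (this hcj)

end Distinguish

theorem isDPMinimal_of_hasQE {ι : Type u} {Ω : Type v} [(lang ι).Structure Ω]
    (hD : IsDSet (dRel ι Ω)) (hT : HasQE ((lang ι).completeTheory Ω)) :
    IsDPMinimal.{0, u, w, x, y} ((lang ι).completeTheory Ω) := by
  intro M _ _ I J _ _ _ _ m n a b hab c
  exact hab.isIndiscernibleOver_or hT hD.of_model c

/-! ### Quantifier elimination from ultrahomogeneity -/

theorem isQF_iInf {L : FirstOrder.Language.{u, v}} {α β : Type*} [Finite β]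
    {f : β → L.Formula α} (hf : ∀ b, (f b).IsQF) : (Formula.iInf f).IsQF := by
  have key : ∀ l : List (L.Formula α), (∀ φ ∈ l, φ.IsQF) →
      BoundedFormula.IsQF (l.foldr (· ⊓ ·) ⊤) := by
    intro l
    induction l with
    | nil => exact fun _ => .top
    | cons φ l ih =>
      exact fun h => (h φ (by simp)).inf (ih fun χ hχ => h χ (List.mem_cons_of_mem _ hχ))
  refine key _ fun φ hφ => ?_
  obtain ⟨b, -, rfl⟩ := List.mem_map.1 hφ
  exact hf b

theorem isQF_iSup {L : FirstOrder.Language.{u, v}} {α β : Type*} [Finite β]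
    {f : β → L.Formula α} (hf : ∀ b, (f b).IsQF) : (Formula.iSup f).IsQF := by
  have key : ∀ l : List (L.Formula α), (∀ φ ∈ l, φ.IsQF) →
      BoundedFormula.IsQF (l.foldr (· ⊔ ·) ⊥) := by
    intro l
    induction l with
    | nil => exact fun _ => .falsum
    | cons φ l ih =>
      exact fun h => (h φ (by simp)).sup (ih fun χ hχ => h χ (List.mem_cons_of_mem _ hχ))
  refine key _ fun φ hφ => ?_
  obtain ⟨b, -, rfl⟩ := List.mem_map.1 hφ
  exact hf b

/-- If the truth of a formula in `Ω` is determined by that of finitely many quantifier-free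
formulas, then it is equivalent to a quantifier-free formula. -/
theorem exists_isQF_of_finite {L : FirstOrder.Language.{u, v}} {Ω : Type w} [L.Structure Ω]
    {α β : Type*} [Finite β] (θ : β → L.Formula α) (hθ : ∀ t, (θ t).IsQF) (φ : L.Formula α)
    (h : ∀ v v' : α → Ω, (∀ t, (θ t).Realize v ↔ (θ t).Realize v') → φ.Realize v → φ.Realize v') :
    ∃ ψ : L.Formula α, ψ.IsQF ∧ ∀ v : α → Ω, φ.Realize v ↔ ψ.Realize v := by
  classical
  let K : Set (β → Prop) := {κ | ∃ v : α → Ω, φ.Realize v ∧ ∀ t, κ t ↔ (θ t).Realize v}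
  let χ : (β → Prop) → β → L.Formula α := fun κ t => if κ t then θ t else (θ t).not
  have hχ (κ t) (v : α → Ω) : (χ κ t).Realize v ↔ (κ t ↔ (θ t).Realize v) := by
    by_cases hκ : κ t <;> simp [χ, hκ, Formula.realize_not]
  refine ⟨Formula.iSup fun κ : K => Formula.iInf (χ κ.1),
    isQF_iSup fun κ => isQF_iInf fun t => ?_, fun v => ?_⟩
  · by_cases hκ : κ.1 t
    · simpa only [χ, if_pos hκ] using hθ t
    · simpa only [χ, if_neg hκ] using (hθ t).not
  · simp only [Formula.realize_iSup, Formula.realize_iInf, hχ]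
    constructor
    · exact fun hv => ⟨⟨fun t => (θ t).Realize v, v, hv, fun t => Iff.rfl⟩, fun t => Iff.rfl⟩
    · rintro ⟨⟨κ, v₀, hv₀, hκ⟩, hv⟩
      exact h v₀ v (fun t => (hκ t).symm.trans (hv t)) hv₀

/-- As the language is relational, the range of `v` is a finitely generated substructure, and `v p ↦
v' p` is an embedding of it, to be extended by homogeneity. -/
theorem exists_equiv_of_agree {ι : Type u} {Ω : Type v} [(lang ι).Structure Ω]
    (hΩ : (lang ι).IsUltrahomogeneous Ω) {α : Type*} [Finite α] {v v' : α → Ω}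
    (heq : ∀ p q, v p = v q ↔ v' p = v' q)
    (hd : ∀ p q r s, dRel ι Ω (v p) (v q) (v r) (v s) ↔ dRel ι Ω (v' p) (v' q) (v' r) (v' s))
    (hP : ∀ i p, v p ∈ colorSet (ι := ι) Ω i ↔ v' p ∈ colorSet (ι := ι) Ω i) :
    ∃ g : Ω ≃[lang ι] Ω, g ∘ v = v' := by
  let S : (lang ι).Substructure Ω := ⟨Set.range v, fun f => isEmptyElim f⟩
  have hS : S.FG := Substructure.fg_iff_finite.2 (Set.finite_range v)
  choose u hu using fun x : S => (x.2 : (x : Ω) ∈ Set.range v)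
  let f : S ↪[lang ι] Ω :=
    { toFun := fun x => v' (u x)
      inj' := fun x y hxy => Subtype.ext (by rw [← hu x, ← hu y]; exact (heq _ _).2 hxy)
      map_fun' := fun f => isEmptyElim f
      map_rel' := fun {k} R xs => by
        change _ ↔ Structure.RelMap R (fun l => (xs l : Ω))
        simp only [← hu]
        cases R with
        | d => exact (relMap_d_iff _).trans ((hd _ _ _ _).symm.trans (relMap_d_iff fun l => v (u (xs l))).symm)
        | color i =>
          exact (relMap_color_iff i _).trans ((hP i _).symm.trans (relMap_color_iff i fun l => v (u (xs l))).symm) }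
  obtain ⟨g, hg⟩ := hΩ S hS f
  refine ⟨g, funext fun p => ?_⟩
  have h₁ : f ⟨v p, p, rfl⟩ = g (v p) := by rw [hg]; rfl
  exact h₁.symm.trans ((heq _ _).1 (hu ⟨v p, p, rfl⟩))

theorem hasQE_of_isUltrahomogeneous {ι : Type u} [Finite ι] {Ω : Type v} [(lang ι).Structure Ω]
    (hΩ : (lang ι).IsUltrahomogeneous Ω) : HasQE ((lang ι).completeTheory Ω) := by
  intro n φ
  let β := (Fin n × Fin n) ⊕ (Fin n × Fin n × Fin n × Fin n) ⊕ (ι × Fin n)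
  let θ : β → (lang ι).Formula (Fin n) := Sum.elim (fun p => Term.equal (.var p.1) (.var p.2))
    (Sum.elim (fun p => dFormula p.1 p.2.1 p.2.2.1 p.2.2.2) (fun p => colorFormula p.1 p.2))
  obtain ⟨ψ, hψ, h⟩ := exists_isQF_of_finite (Ω := Ω) θ
    (by
      rintro (p | p | p)
      · exact (BoundedFormula.IsAtomic.equal _ _).isQF
      · exact (BoundedFormula.IsAtomic.rel _ _).isQF
      · exact (BoundedFormula.IsAtomic.rel _ _).isQF) φ
    (fun v v' hv h => by
      obtain ⟨g, rfl⟩ := exists_equiv_of_agree hΩ (v := v) (v' := v')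
        (fun p q => by simpa [θ] using hv (.inl (p, q)))
        (fun p q r s => by simpa [θ] using hv (.inr (.inl (p, q, r, s))))
        (fun i p => by simpa [θ] using hv (.inr (.inr (i, p))))
      exact (StrongHomClass.realize_formula g φ).2 h)
  -- The equivalence is known in `Ω` only; its universal closure carries it to every model.
  refine ⟨ψ, hψ, fun N v xs => ?_⟩
  have := realize_of_forall_realize (Ω := Ω) (M := N) (φ.iff ψ)
    (fun v => Formula.realize_iff.2 (h v)) v
  rwa [Subsingleton.elim xs default]

end ColoredDSet

theorem theorem2 :
    (∀ (ι : Type u) (Ω : Type v) [(ColoredDSet.lang ι).Structure Ω],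
      ColoredDSet.IsDSet (ColoredDSet.dRel ι Ω) →
      ColoredDSet.HasQE ((ColoredDSet.lang ι).completeTheory Ω) →
      ColoredDSet.IsDPMinimal.{0, u, w, x, y} ((ColoredDSet.lang ι).completeTheory Ω)) ∧
    (∀ (k : ℕ) (Ω : Type v) [Countable Ω] [(ColoredDSet.lang (Fin k)).Structure Ω],
      ColoredDSet.IsProperDSet (ColoredDSet.dRel (Fin k) Ω) →
      ColoredDSet.IsColoring (ColoredDSet.colorSet Ω : Fin k → Set Ω) →
      (ColoredDSet.lang (Fin k)).IsUltrahomogeneous Ω →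
      ColoredDSet.IsDPMinimal.{0, 0, w, x, y}
        ((ColoredDSet.lang (Fin k)).completeTheory Ω)) := by
  refine ⟨fun ι Ω _ hD hT => ColoredDSet.isDPMinimal_of_hasQE hD hT, ?_⟩
  intro k Ω _ _ hD _ hΩ
  exact ColoredDSet.isDPMinimal_of_hasQE hD.toIsDSet (ColoredDSet.hasQE_of_isUltrahomogeneous hΩ)
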